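/- There is a universal constant $C>0$ such that for every $\kappa\ge 0$ and $\eta>0$ there is an $N$, depending only on $\kappa$ and $\eta$, with the following property. Let $n\ge N$, $r\ge 2$, $d$ be integers, let $C_1,\dots,C_r$ be a partition of $\{1,\dots,n\}$ into $r$ non-empty clusters of sizes $m_1,\dots,m_r$, and let $\mu_1,\dots,\mu_r\in\mathbb{R}^d$ be distinct centers. Let $Y_i=\mu_a+W_i$ for $i\in C_a$, where $W_1,\dots,W_n$ are independent random vectors in $\mathbb{R}^d$ with $\mathbb{E}W_i=0$ and $\mathrm{Cov}(W_i)=\sigma_a^2 I$ for $i\in C_a$, and which are subgaussian: $\mathbb{E}\,e^{t\langle u,W_i\rangle}\le e^{\kappa\sigma_{\max}^2t^2/2}$ for all unit vectors $u$ and all $t\in\mathbb{R}$. Here $\sigma_{\max}^2=\max_a\|\sigma_a^2I\|_{\mathrm{op}}$ is the largest operator norm of the covariance matrices of the components. For an assignment of the $n$ points to $r$ non-empty clusters with binary membership matrix $Z\in\{0,1\}^{n\times r}$, its normalized clustering matrix is $X=Z(Z^TZ)^{-1}Z^T$; let $X_0$ be that of $C_1,\dots,C_r$. Write $\langle A,B\rangle=\mathrm{trace}(A^TB)$,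 $\pi_{\min}=\min_k m_k/n$, $\pi_{\max}=\max_k m_k/n$, $\alpha=\pi_{\max}/\pi_{\min}$, $\delta_{\mathrm{sep}}=\min_{k\ne\ell}\|\mu_k-\mu_\ell\|$. Let $\hat S_{ij}=-\|Y_i-Y_j\|^2$, and let $S$ be the random reference matrix with, for $i\in C_a$, $j\in C_b$ and $d_{ab}=\|\mu_a-\mu_b\|$, $$S_{ij}=-\frac{d_{ab}^2}{2}-\max\Bigl\{0,\ \frac{d_{ab}^2}{2}+2(W_i-W_j)^T(\mu_a-\mu_b)\Bigr\}.$$ Given bandwidths $\theta_1,\dots,\theta_T>0$, let $\hat Z_{\theta_t}$ be an output of spectral clustering ($k$-means into $r$ non-empty clusters of the rows of the matrix of top $r$ eigenvectors) of the Gaussian kernel matrix $\exp\bigl(-\|Y_i-Y_j\|^2/(2\theta_t^2)\bigr)$, with normalized clustering matrix $\hat X_{\theta_t}$. MATR selects $\theta^*\in\{\theta_1,\dots,\theta_T\}$ maximizing $\langle\hat S,\hat X_{\theta_t}\rangle$. Then, with probability at least $1-\eta$, the following holds for all such candidate lists, all outputs $\hat Z_{\theta_t}$, all maximizers $\theta^*$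 and all real $\varepsilon$: if some $\theta_0\in\{\theta_1,\dots,\theta_T\}$ satisfies $\langle\hat X_{\theta_0},\hat S\rangle\ge\langle X_0,S\rangle-n\pi_{\min}\varepsilon$, then $$\|\hat X_{\theta^*}-X_0\|_F^2\le C\,\frac{\varepsilon+r\alpha\sigma_{\max}^2(\alpha+\min\{r,d\})}{\delta_{\mathrm{sep}}^2}.$$ -/

import Mathlib

open MeasureTheory ProbabilityTheory
open scoped NNReal ENNReal

noncomputable section

namespace MATR

variable {n d r : ℕ}

/-! ### Clusterings -/

/-- The `n × r` binary membership matrix `Z` of an assignment of `n` points to `r` clusters. -/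
def membershipMatrix (z : Fin n → Fin r) : Matrix (Fin n) (Fin r) ℝ :=
  Matrix.of fun i k => if z i = k then 1 else 0

/-- The normalized clustering matrix `Z (Zᵀ Z)⁻¹ Zᵀ`. The inverse is a genuine one as soon as all
`r` clusters are non-empty, that is, as soon as the assignment is surjective. -/
def normalizedClustering (z : Fin n → Fin r) : Matrix (Fin n) (Fin n) ℝ :=
  membershipMatrix z * ((membershipMatrix z).transpose * membershipMatrix z)⁻¹ *
    (membershipMatrix z).transpose

/-- The size `m_k` of cluster `k`. -/
def clusterSize (z : Fin n → Fin r) (k : Fin r) : ℕ :=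
  (Finset.univ.filter fun i => z i = k).card

/-- The smallest cluster proportion. -/
def piMin (z : Fin n → Fin r) : ℝ := ⨅ k, (clusterSize z k : ℝ) / n

/-- The largest cluster proportion. -/
def piMax (z : Fin n → Fin r) : ℝ := ⨆ k, (clusterSize z k : ℝ) / n

/-- The inner product `⟨A, B⟩ = trace (Aᵀ B)`. -/
def traceInner (A B : Matrix (Fin n) (Fin n) ℝ) : ℝ := (A.transpose * B).trace

/-- The squared Frobenius norm. -/
def frobSq (A : Matrix (Fin n) (Fin n) ℝ) : ℝ := ∑ i, ∑ j, A i j ^ 2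

/-! ### Spectral clustering on the Gaussian kernel -/

/-- The Gaussian kernel matrix with bandwidth `θ`. -/
def gaussianKernel (Y : Fin n → EuclideanSpace ℝ (Fin d)) (θ : ℝ) : Matrix (Fin n) (Fin n) ℝ :=
  Matrix.of fun i j => Real.exp (-(‖Y i - Y j‖ ^ 2) / (2 * θ ^ 2))

/-- The columns of `V` are eigenvectors of `M` for its `r` largest eigenvalues: they are the first
`r` members of an orthonormal eigenbasis sorted by decreasing eigenvalue. -/
def IsTopEigenvectors (M : Matrix (Fin n) (Fin n) ℝ) (V : Matrix (Fin n) (Fin r) ℝ) : Prop :=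
  ∃ (hrn : r ≤ n) (b : OrthonormalBasis (Fin n) ℝ (EuclideanSpace ℝ (Fin n))) (ev : Fin n → ℝ),
    Antitone ev ∧
    (∀ l i, (M.mulVec fun j => b l j) i = ev l * b l i) ∧
    ∀ i k, V i k = b (Fin.castLE hrn k) i

/-- The `k`-means objective of an assignment `z` with centers `c`. -/
def kmeansCost {m : ℕ} (x : Fin n → EuclideanSpace ℝ (Fin m)) (z : Fin n → Fin r)
    (c : Fin r → EuclideanSpace ℝ (Fin m)) : ℝ :=
  ∑ i, ‖x i - c (z i)‖ ^ 2

/-- `z` is a `k`-means clustering of the points `x` into `r` non-empty clusters: a global minimizer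
of the `k`-means objective. -/
def IsKMeans {m : ℕ} (x : Fin n → EuclideanSpace ℝ (Fin m)) (z : Fin n → Fin r) : Prop :=
  Function.Surjective z ∧
    ∃ c : Fin r → EuclideanSpace ℝ (Fin m),
      ∀ (z' : Fin n → Fin r) (c' : Fin r → EuclideanSpace ℝ (Fin m)),
        kmeansCost x z c ≤ kmeansCost x z' c'

/-- `z` is an output of spectral clustering of the similarity matrix `M` into `r` clusters:
`k`-means on the rows of the matrix of the top `r` eigenvectors of `M`. Ties, both between
eigenvectors and between minimizers, may be broken in any way. -/
def IsSpectralClustering (M : Matrix (Fin n) (Fin n) ℝ) (z : Fin n → Fin r) : Prop :=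
  ∃ V : Matrix (Fin n) (Fin r) ℝ, IsTopEigenvectors M V ∧
    IsKMeans (fun i => (WithLp.toLp 2 (V i) : EuclideanSpace ℝ (Fin r))) z

/-! ### The MATR selection rule -/

/-- `tstar` is a choice of the MATR algorithm: among the candidate clusterings `z t` it maximizes
the trace criterion `⟨Shat, X_t⟩`. -/
def IsMATRChoice {T : ℕ} (Shat : Matrix (Fin n) (Fin n) ℝ) (z : Fin T → Fin n → Fin r)
    (tstar : Fin T) : Prop :=
  ∀ t, traceInner Shat (normalizedClustering (z t)) ≤
    traceInner Shat (normalizedClustering (z tstar))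

/-! ### Mixtures of subgaussians -/

/-- The covariance matrix `σ_a² I` of the `a`-th mixture component. -/
def componentCov (d : ℕ) (σ : Fin r → ℝ) (a : Fin r) : Matrix (Fin d) (Fin d) ℝ :=
  σ a ^ 2 • (1 : Matrix (Fin d) (Fin d) ℝ)

/-- `σ_max²`: the largest operator norm of the covariance matrices of the components. -/
def sigmaMaxSq (d : ℕ) (σ : Fin r → ℝ) : ℝ :=
  ⨆ a, ‖Matrix.toEuclideanCLM (n := Fin d) (𝕜 := ℝ) (componentCov d σ a)‖

/-- The noise `W` of a mixture with true assignment `z₀`: independent, centered random vectors with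
`Cov (W i) = σ_a² I` for `i` in cluster `a`, and subgaussian: every one-dimensional marginal has
variance proxy at most `κ σ_max²`. -/
structure IsSubgaussianNoise {Ω : Type*} [MeasurableSpace Ω] (P : Measure Ω)
    (z₀ : Fin n → Fin r) (σ : Fin r → ℝ) (κ : ℝ≥0)
    (W : Fin n → Ω → EuclideanSpace ℝ (Fin d)) : Prop where
  measurable : ∀ i, Measurable (W i)
  indep : iIndepFun W P
  mean_zero : ∀ i, ∫ ω, W i ω ∂P = 0
  cov : ∀ i j k, covariance (fun ω => W i ω j) (fun ω => W i ω k) P = componentCov d σ (z₀ i) j k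
  subgaussian : ∀ i (u : EuclideanSpace ℝ (Fin d)), ‖u‖ = 1 →
    HasSubgaussianMGF (fun ω => inner ℝ u (W i ω)) (κ * (sigmaMaxSq d σ).toNNReal) P

/-- The data points `Y_i = μ_a + w_i` for `i` in cluster `a`. -/
def mixtureData (z₀ : Fin n → Fin r) (μ : Fin r → EuclideanSpace ℝ (Fin d))
    (w : Fin n → EuclideanSpace ℝ (Fin d)) (i : Fin n) : EuclideanSpace ℝ (Fin d) :=
  μ (z₀ i) + w i

/-- The negative squared distance matrix. -/
def negSqDist (Y : Fin n → EuclideanSpace ℝ (Fin d)) : Matrix (Fin n) (Fin n) ℝ :=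
  Matrix.of fun i j => -(‖Y i - Y j‖ ^ 2)

/-- The (random) reference matrix `S`: for `i` in cluster `a` and `j` in cluster `b`,
`S i j = -d_ab²/2 - max {0, d_ab²/2 + 2 ⟨w i - w j, μ a - μ b⟩}` with `d_ab = ‖μ a - μ b‖`. -/
def referenceMatrix (z₀ : Fin n → Fin r) (μ : Fin r → EuclideanSpace ℝ (Fin d))
    (w : Fin n → EuclideanSpace ℝ (Fin d)) : Matrix (Fin n) (Fin n) ℝ :=
  Matrix.of fun i j =>
    -(‖μ (z₀ i) - μ (z₀ j)‖ ^ 2 / 2) -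
      max 0 (‖μ (z₀ i) - μ (z₀ j)‖ ^ 2 / 2 + 2 * inner ℝ (w i - w j) (μ (z₀ i) - μ (z₀ j)))

/-- The minimum distance between distinct cluster centers. -/
def deltaSep (μ : Fin r → EuclideanSpace ℝ (Fin d)) : ℝ :=
  ⨅ p : {p : Fin r × Fin r // p.1 ≠ p.2}, ‖μ p.1.1 - μ p.1.2‖

end MATR

end

/-! Normalized clustering matrices are nonnegative and symmetric with row sums one. `X₀` lives on
within-cluster pairs, exactly where `S` vanishes, so `⟨X₀, S⟩ = 0`. The assumption on `θ₀`, passed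
on to the maximizer `X`, therefore bounds the scatter: `∑ X i j * ‖Y i - Y j‖² ≤ n π_min ε`.

Scatter controls center distances without the full noise norm: projecting onto the span of the
centers preserves `μ a - μ b` and leaves noise in at most `min r d` directions. Row and column sums
one then give `∑ X i j * d² ≤ 2 * scatter + 8 * (projected noise)` (`sum_center_dist_le`).
Conversely, `‖X - X₀‖²` is governed by the mass of `X` on separated pairs, each of which has `d ≥
δ_sep` (`frobSq_sub_le`).

Only the projected noise energy is random. It has mean at most `n * min r d * σ_max²`, and Chebyshev
with subgaussian fourth moments shows that it exceeds twice this with probability at most `96 κ² /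
n` (`measure_noise_gt_le`). -/

namespace MATR

/-! ### Algebra of normalized clustering matrices. -/

section Deterministic

variable {n d r : ℕ}

lemma membership_gram (z : Fin n → Fin r) :
    (membershipMatrix z).transpose * membershipMatrix z =
      Matrix.diagonal fun k => (clusterSize z k : ℝ) := by
  ext k l
  simp only [Matrix.mul_apply, Matrix.transpose_apply, membershipMatrix, Matrix.of_apply,
    Matrix.diagonal_apply, clusterSize, Finset.card_filter]
  by_cases h : k = l
  · subst h
    rw [if_pos rfl, Nat.cast_sum]
    refine Finset.sum_congr rfl fun i _ => ?_
    split_ifs <;> simp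
  · rw [if_neg h]
    refine Finset.sum_eq_zero fun i _ => ?_
    by_cases h1 : z i = k
    · simp [h1, h]
    · simp [h1]

lemma clusterSize_pos {z : Fin n → Fin r} (hz : Function.Surjective z) (k : Fin r) :
    0 < (clusterSize z k : ℝ) := by
  obtain ⟨i, hi⟩ := hz k
  exact_mod_cast Finset.card_pos.2 ⟨i, by simp [hi]⟩

lemma normalizedClustering_apply {z : Fin n → Fin r} (hz : Function.Surjective z) (i j : Fin n) :
    normalizedClustering z i j = if z i = z j then (clusterSize z (z i) : ℝ)⁻¹ else 0 := by
  have hinv : (Matrix.diagonal fun k => (clusterSize z k : ℝ))⁻¹ =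
      Matrix.diagonal fun k => (clusterSize z k : ℝ)⁻¹ := by
    refine Matrix.inv_eq_right_inv ?_
    rw [Matrix.diagonal_mul_diagonal, ← Matrix.diagonal_one]
    congr 1
    ext k
    exact mul_inv_cancel₀ (clusterSize_pos hz k).ne'
  rw [normalizedClustering, membership_gram, hinv, Matrix.mul_apply]
  simp only [Matrix.mul_diagonal, Matrix.transpose_apply, membershipMatrix, Matrix.of_apply]
  by_cases h : z i = z j <;> simp [h]

lemma normalizedClustering_nonneg {z : Fin n → Fin r} (hz : Function.Surjective z)
    (i j : Fin n) : 0 ≤ normalizedClustering z i j := by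
  rw [normalizedClustering_apply hz]
  split_ifs
  · exact inv_nonneg.2 (clusterSize_pos hz _).le
  · exact le_rfl

lemma normalizedClustering_symm {z : Fin n → Fin r} (hz : Function.Surjective z) (i j : Fin n) :
    normalizedClustering z i j = normalizedClustering z j i := by
  rw [normalizedClustering_apply hz, normalizedClustering_apply hz]
  by_cases h : z i = z j
  · simp [h]
  · simp [h, Ne.symm h]

lemma normalizedClustering_row_sum {z : Fin n → Fin r} (hz : Function.Surjective z) (i : Fin n) :
    ∑ j, normalizedClustering z i j = 1 := by
  simp_rw [normalizedClustering_apply hz]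
  rw [← Finset.sum_filter, Finset.sum_const, nsmul_eq_mul]
  have : (Finset.univ.filter fun j => z i = z j).card = clusterSize z (z i) := by
    simp [clusterSize, eq_comm]
  rw [this]
  exact mul_inv_cancel₀ (clusterSize_pos hz _).ne'

/-- Each cluster contributes one. Read backwards, this spreads `r`, a squared Frobenius norm, over
the points. -/
lemma sum_inv_clusterSize {z : Fin n → Fin r} (hz : Function.Surjective z) :
    ∑ i, (clusterSize z (z i) : ℝ)⁻¹ = r := by
  rw [← Finset.sum_fiberwise Finset.univ z]
  have : ∀ k : Fin r, ∑ i ∈ Finset.univ.filter (fun i => z i = k),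
      (clusterSize z (z i) : ℝ)⁻¹ = 1 := by
    intro k
    rw [Finset.sum_congr rfl (g := fun _ => (clusterSize z k : ℝ)⁻¹)
      (fun i hi => by rw [(Finset.mem_filter.1 hi).2]), Finset.sum_const, nsmul_eq_mul]
    exact mul_inv_cancel₀ (clusterSize_pos hz _).ne'
  simp [this]

/-- The squared Frobenius norm of a normalized clustering matrix is the number of clusters. -/
lemma frobSq_normalizedClustering {z : Fin n → Fin r} (hz : Function.Surjective z) :
    frobSq (normalizedClustering z) = r := by
  rw [frobSq, ← sum_inv_clusterSize hz]
  refine Finset.sum_congr rfl fun i _ => ?_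
  have : ∀ j, normalizedClustering z i j ^ 2 =
      (clusterSize z (z i) : ℝ)⁻¹ * normalizedClustering z i j := by
    intro j
    rw [normalizedClustering_apply hz]
    split_ifs <;> ring
  simp_rw [this]
  rw [← Finset.mul_sum, normalizedClustering_row_sum hz, mul_one]

lemma traceInner_eq_sum (A B : Matrix (Fin n) (Fin n) ℝ) :
    traceInner A B = ∑ i, ∑ j, A i j * B i j := by
  simp only [traceInner, Matrix.trace, Matrix.diag, Matrix.mul_apply, Matrix.transpose_apply]
  exact Finset.sum_comm

lemma frobSq_sub (A B : Matrix (Fin n) (Fin n) ℝ) :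
    frobSq (A - B) = frobSq A + frobSq B - 2 * ∑ i, ∑ j, A i j * B i j := by
  simp only [frobSq, Finset.mul_sum, ← Finset.sum_add_distrib, ← Finset.sum_sub_distrib]
  refine Finset.sum_congr rfl fun i _ => Finset.sum_congr rfl fun j _ => ?_
  rw [Matrix.sub_apply]
  ring

/-! ### Cluster proportions, separation, and the deterministic error bound. -/

lemma size_pos_of_surjective {z : Fin n → Fin r} (hz : Function.Surjective z) (hr : 2 ≤ r) :
    0 < n := by
  obtain ⟨i, -⟩ := hz ⟨0, by omega⟩
  exact i.pos

lemma piMin_mul_le {z : Fin n → Fin r} (hn : 0 < n) (k : Fin r) :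
    n * piMin z ≤ clusterSize z k := by
  have h : piMin z ≤ (clusterSize z k : ℝ) / n := ciInf_le (Set.finite_range _).bddBelow k
  have hn' : (0 : ℝ) < n := by exact_mod_cast hn
  rw [le_div_iff₀ hn'] at h
  linarith

lemma piMin_pos {z : Fin n → Fin r} (hz : Function.Surjective z) (hr : 2 ≤ r) : 0 < piMin z := by
  have : Nonempty (Fin r) := ⟨⟨0, by omega⟩⟩
  obtain ⟨k, hk⟩ := exists_eq_ciInf_of_finite (f := fun k => (clusterSize z k : ℝ) / n)
  have hn : (0 : ℝ) < n := by exact_mod_cast size_pos_of_surjective hz hr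
  rw [piMin, ← hk]
  exact div_pos (clusterSize_pos hz k) hn

/-- The proportions sum to one, so the largest is at least their average. -/
lemma one_le_mul_piMax {z : Fin n → Fin r} (hz : Function.Surjective z) (hr : 2 ≤ r) :
    1 ≤ r * piMax z := by
  have hn : (0 : ℝ) < n := by exact_mod_cast size_pos_of_surjective hz hr
  have h : ∀ k ∈ Finset.univ, (clusterSize z k : ℝ) / n ≤ piMax z := fun k _ =>
    le_ciSup (f := fun k => (clusterSize z k : ℝ) / n) (Set.finite_range _).bddAbove k
  have h2 := Finset.sum_le_card_nsmul _ _ _ h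
  have h3 : ∑ k, clusterSize z k = n := by
    have := Finset.card_eq_sum_card_fiberwise (f := z) (s := Finset.univ) (t := Finset.univ)
      (fun _ _ => by simp)
    simpa [clusterSize] using this.symm
  rw [← Finset.sum_div, ← Nat.cast_sum, h3, div_self hn.ne'] at h2
  simpa using h2

lemma deltaSep_pos {μ : Fin r → EuclideanSpace ℝ (Fin d)} (hμ : Function.Injective μ)
    (hr : 2 ≤ r) : 0 < deltaSep μ := by
  have : Nonempty {p : Fin r × Fin r // p.1 ≠ p.2} :=
    ⟨⟨(⟨0, by omega⟩, ⟨1, by omega⟩), by simp⟩⟩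
  obtain ⟨p, hp⟩ := exists_eq_ciInf_of_finite
    (f := fun p : {p : Fin r × Fin r // p.1 ≠ p.2} => ‖μ p.1.1 - μ p.1.2‖)
  rw [deltaSep, ← hp, norm_pos_iff, sub_ne_zero]
  exact hμ.ne p.2

lemma deltaSep_le (μ : Fin r → EuclideanSpace ℝ (Fin d)) {a b : Fin r} (h : a ≠ b) :
    deltaSep μ ≤ ‖μ a - μ b‖ :=
  ciInf_le (f := fun p : {p : Fin r × Fin r // p.1 ≠ p.2} => ‖μ p.1.1 - μ p.1.2‖)
    (Set.finite_range _).bddBelow ⟨(a, b), h⟩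

/-- The distance between two clustering matrices is controlled by the mass that the first one puts
on pairs of points that the second one separates, hence by the between-center distances. -/
lemma frobSq_sub_le {z z₀ : Fin n → Fin r} (hz : Function.Surjective z)
    (hz₀ : Function.Surjective z₀) (hr : 2 ≤ r) {μ : Fin r → EuclideanSpace ℝ (Fin d)}
    (hμ : Function.Injective μ) :
    frobSq (normalizedClustering z - normalizedClustering z₀) ≤
      2 * (∑ i, ∑ j, normalizedClustering z i j * ‖μ (z₀ i) - μ (z₀ j)‖ ^ 2) /
        (n * piMin z₀ * deltaSep μ ^ 2) := by
  have hn := size_pos_of_surjective hz₀ hr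
  have hp : 0 < n * piMin z₀ := mul_pos (by exact_mod_cast hn) (piMin_pos hz₀ hr)
  have hδ := deltaSep_pos hμ hr
  rw [frobSq_sub, frobSq_normalizedClustering hz, frobSq_normalizedClustering hz₀,
    ← sum_inv_clusterSize hz₀, ← two_mul, ← mul_sub, ← Finset.sum_sub_distrib, mul_div_assoc,
    Finset.sum_div]
  refine mul_le_mul_of_nonneg_left (Finset.sum_le_sum fun i _ => ?_) zero_le_two
  have hm := clusterSize_pos hz₀ (z₀ i)
  -- Weighting by row `i` of `X` makes the comparison termwise: pairs in a common true cluster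
  -- cancel, separated pairs remain.
  have hsplit : (clusterSize z₀ (z₀ i) : ℝ)⁻¹ =
      ∑ j, normalizedClustering z i j * (clusterSize z₀ (z₀ i) : ℝ)⁻¹ := by
    rw [← Finset.sum_mul, normalizedClustering_row_sum hz, one_mul]
  nth_rw 1 [hsplit]
  rw [← Finset.sum_sub_distrib, Finset.sum_div]
  refine Finset.sum_le_sum fun j _ => ?_
  have hX := normalizedClustering_nonneg hz i j
  rw [normalizedClustering_apply hz₀ i j]
  by_cases h : z₀ i = z₀ j
  · simp [h]
  · rw [if_neg h, mul_zero, sub_zero, mul_div_assoc]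
    refine mul_le_mul_of_nonneg_left ?_ hX
    rw [inv_eq_one_div, div_le_div_iff₀ hm (by positivity), one_mul, mul_comm]
    exact mul_le_mul (pow_le_pow_left₀ hδ.le (deltaSep_le μ h) 2) (piMin_mul_le hn _) hp.le
      (by positivity)

/-- Disjoint supports: within a true cluster the center difference is zero, hence so is the entry of
`S`. -/
lemma traceInner_referenceMatrix {z₀ : Fin n → Fin r} (hz₀ : Function.Surjective z₀)
    (μ : Fin r → EuclideanSpace ℝ (Fin d)) (w : Fin n → EuclideanSpace ℝ (Fin d)) :
    traceInner (normalizedClustering z₀) (referenceMatrix z₀ μ w) = 0 := by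
  rw [traceInner_eq_sum]
  refine Finset.sum_eq_zero fun i _ => Finset.sum_eq_zero fun j _ => ?_
  rw [normalizedClustering_apply hz₀]
  split_ifs with h
  · simp [referenceMatrix, h]
  · simp

lemma traceInner_negSqDist (A : Matrix (Fin n) (Fin n) ℝ)
    (Y : Fin n → EuclideanSpace ℝ (Fin d)) :
    traceInner A (negSqDist Y) = -∑ i, ∑ j, A i j * ‖Y i - Y j‖ ^ 2 := by
  simp [traceInner_eq_sum, negSqDist]

lemma traceInner_comm (A B : Matrix (Fin n) (Fin n) ℝ) : traceInner A B = traceInner B A := by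
  simp only [traceInner_eq_sum, mul_comm]

/-- The span of the centers has an orthonormal basis of at most `min r d` vectors. -/
lemma exists_orthonormal_centers (μ : Fin r → EuclideanSpace ℝ (Fin d)) :
    ∃ (q : ℕ) (u : Fin q → EuclideanSpace ℝ (Fin d)), q ≤ min r d ∧ Orthonormal ℝ u ∧
      ∀ a b, ∑ l, inner ℝ (u l) (μ a - μ b) ^ 2 = ‖μ a - μ b‖ ^ 2 := by
  set U := Submodule.span ℝ (Set.range μ)
  have b := stdOrthonormalBasis ℝ U
  refine ⟨_, fun l => (b l : EuclideanSpace ℝ (Fin d)), le_min ?_ ?_, ?_, fun a a' => ?_⟩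
  · exact (finrank_range_le_card (R := ℝ) μ).trans_eq (Fintype.card_fin r)
  · simpa using Submodule.finrank_le U
  · exact b.orthonormal.comp_linearIsometry U.subtypeₗᵢ
  · have h := b.sum_sq_norm_inner_right
      ⟨μ a - μ a', U.sub_mem (Submodule.subset_span ⟨a, rfl⟩) (Submodule.subset_span ⟨a', rfl⟩)⟩
    simpa using h

lemma sum_inner_sq_le {q : ℕ} {u : Fin q → EuclideanSpace ℝ (Fin d)} (hu : Orthonormal ℝ u)
    (x : EuclideanSpace ℝ (Fin d)) : ∑ l, inner ℝ (u l) x ^ 2 ≤ ‖x‖ ^ 2 := by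
  simpa using hu.sum_inner_products_le (s := Finset.univ) x

/-- Between-center distances are recovered from the data up to the noise in the directions `u`. -/
lemma sum_center_dist_le {z z₀ : Fin n → Fin r} (hz : Function.Surjective z)
    {μ : Fin r → EuclideanSpace ℝ (Fin d)} {q : ℕ} {u : Fin q → EuclideanSpace ℝ (Fin d)}
    (hu : Orthonormal ℝ u)
    (hμu : ∀ a b, ∑ l, inner ℝ (u l) (μ a - μ b) ^ 2 = ‖μ a - μ b‖ ^ 2)
    (w : Fin n → EuclideanSpace ℝ (Fin d)) :
    ∑ i, ∑ j, normalizedClustering z i j * ‖μ (z₀ i) - μ (z₀ j)‖ ^ 2 ≤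
      2 * ∑ i, ∑ j, normalizedClustering z i j *
          ‖mixtureData z₀ μ w i - mixtureData z₀ μ w j‖ ^ 2 +
        8 * ∑ i, ∑ l, inner ℝ (u l) (w i) ^ 2 := by
  set G : Fin n → ℝ := fun i => ∑ l, inner ℝ (u l) (w i) ^ 2 with hG
  set Y := mixtureData z₀ μ w with hY
  have hpt : ∀ i j, ‖μ (z₀ i) - μ (z₀ j)‖ ^ 2 ≤ 2 * ‖Y i - Y j‖ ^ 2 + 4 * G i + 4 * G j := by
    intro i j
    have hle : ∀ l, inner ℝ (u l) (μ (z₀ i) - μ (z₀ j)) ^ 2 ≤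
        2 * inner ℝ (u l) (Y i - Y j) ^ 2 + 4 * inner ℝ (u l) (w i) ^ 2 +
          4 * inner ℝ (u l) (w j) ^ 2 := by
      intro l
      have : μ (z₀ i) - μ (z₀ j) = (Y i - Y j) - w i + w j := by
        simp only [hY, mixtureData]
        abel
      rw [this, inner_add_right, inner_sub_right]
      -- `(x - y)² ≤ 2x² + 2y²` applied twice: to data against noise, then to the two noise terms.
      nlinarith [sq_nonneg (inner ℝ (u l) (Y i - Y j) + inner ℝ (u l) (w i) - inner ℝ (u l) (w j)),
        sq_nonneg (inner ℝ (u l) (w i) + inner ℝ (u l) (w j))]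
    rw [← hμu]
    refine (Finset.sum_le_sum fun l _ => hle l).trans ?_
    rw [Finset.sum_add_distrib, Finset.sum_add_distrib, ← Finset.mul_sum, ← Finset.mul_sum,
      ← Finset.mul_sum]
    have := sum_inner_sq_le hu (Y i - Y j)
    simp only [hG]
    linarith
  have hrow : ∑ i, ∑ j, normalizedClustering z i j * G i = ∑ i, G i := by
    refine Finset.sum_congr rfl fun i _ => ?_
    rw [← Finset.sum_mul, normalizedClustering_row_sum hz, one_mul]
  have hcol : ∑ i, ∑ j, normalizedClustering z i j * G j = ∑ i, G i := by
    rw [Finset.sum_comm, ← hrow]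
    simp_rw [normalizedClustering_symm hz]
  calc ∑ i, ∑ j, normalizedClustering z i j * ‖μ (z₀ i) - μ (z₀ j)‖ ^ 2
      ≤ ∑ i, ∑ j, normalizedClustering z i j * (2 * ‖Y i - Y j‖ ^ 2 + 4 * G i + 4 * G j) :=
        Finset.sum_le_sum fun i _ => Finset.sum_le_sum fun j _ =>
          mul_le_mul_of_nonneg_left (hpt i j) (normalizedClustering_nonneg hz i j)
    _ = 2 * (∑ i, ∑ j, normalizedClustering z i j * ‖Y i - Y j‖ ^ 2) +
          4 * (∑ i, ∑ j, normalizedClustering z i j * G i) +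
          4 * (∑ i, ∑ j, normalizedClustering z i j * G j) := by
        simp only [Finset.mul_sum, ← Finset.sum_add_distrib]
        refine Finset.sum_congr rfl fun i _ => Finset.sum_congr rfl fun j _ => ?_
        ring
    _ = _ := by
        rw [hrow, hcol]
        ring

/-- The guarantee holds on the event that the noise along the directions `u` is bounded. -/
lemma frobSq_sub_le_of_noise_le {z z' z₀ : Fin n → Fin r} (hz : Function.Surjective z)
    (hz₀ : Function.Surjective z₀) (hr : 2 ≤ r)
    {μ : Fin r → EuclideanSpace ℝ (Fin d)} (hμ : Function.Injective μ) {q : ℕ}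
    {u : Fin q → EuclideanSpace ℝ (Fin d)} (hu : Orthonormal ℝ u)
    (hμu : ∀ a b, ∑ l, inner ℝ (u l) (μ a - μ b) ^ 2 = ‖μ a - μ b‖ ^ 2)
    {w : Fin n → EuclideanSpace ℝ (Fin d)} {m s ε : ℝ} (hm : 0 ≤ m) (hs : 0 ≤ s)
    (hw : ∑ i, ∑ l, inner ℝ (u l) (w i) ^ 2 ≤ 2 * (n * (m * s)))
    (hmax : traceInner (negSqDist (mixtureData z₀ μ w)) (normalizedClustering z') ≤
      traceInner (negSqDist (mixtureData z₀ μ w)) (normalizedClustering z))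
    (hε : traceInner (normalizedClustering z') (negSqDist (mixtureData z₀ μ w)) ≥
      traceInner (normalizedClustering z₀) (referenceMatrix z₀ μ w) - n * piMin z₀ * ε) :
    frobSq (normalizedClustering z - normalizedClustering z₀) ≤
      32 * ((ε + r * (piMax z₀ / piMin z₀) * s * (piMax z₀ / piMin z₀ + m)) /
        deltaSep μ ^ 2) := by
  have hn : (0 : ℝ) < n := by exact_mod_cast size_pos_of_surjective hz₀ hr
  have hp := piMin_pos hz₀ hr
  have hδ := deltaSep_pos hμ hr
  have hmx := one_le_mul_piMax hz₀ hr
  rw [traceInner_comm _ (normalizedClustering z'), traceInner_comm _ (normalizedClustering z)]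
    at hmax
  rw [traceInner_referenceMatrix hz₀] at hε
  have h1 := hε.le.trans hmax
  rw [traceInner_negSqDist] at h1
  have h2 := sum_center_dist_le (z₀ := z₀) hz hu hμu w
  set A := ∑ i, ∑ j, normalizedClustering z i j *
    ‖mixtureData z₀ μ w i - mixtureData z₀ μ w j‖ ^ 2
  have hA : 0 ≤ A := Finset.sum_nonneg fun i _ => Finset.sum_nonneg fun j _ =>
    mul_nonneg (normalizedClustering_nonneg hz i j) (by positivity)
  -- The scatter is nonnegative and at most `n π_min ε`.
  have hε0 : 0 ≤ ε := by
    by_contra h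
    have := mul_neg_of_pos_of_neg (mul_pos hn hp) (not_le.1 h)
    linarith
  refine (frobSq_sub_le hz hz₀ hr hμ).trans ?_
  rw [← mul_div_assoc, div_le_div_iff₀ (by positivity) (by positivity), ← mul_assoc]
  refine mul_le_mul_of_nonneg_right ?_ (by positivity)
  have hms := mul_nonneg hm hs
  have hα : 0 ≤ piMax z₀ := by
    have hr' : (0 : ℝ) < r := by exact_mod_cast (by omega : 0 < r)
    nlinarith
  -- The factor `r π_max ≥ 1` turns `1 / π_min` into `r α`; the extra `α` summand is nonnegative
  -- slack.
  have h3 : n * (m * s) ≤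
      r * (piMax z₀ / piMin z₀) * s * (piMax z₀ / piMin z₀ + m) * (n * piMin z₀) := by
    have : r * (piMax z₀ / piMin z₀) * s * (piMax z₀ / piMin z₀ + m) * (n * piMin z₀) =
        (r * piMax z₀) * (n * (m * s)) + r * piMax z₀ * s * (piMax z₀ / piMin z₀) * n := by
      field_simp
      ring
    rw [this]
    have h4 : 0 ≤ r * piMax z₀ * s * (piMax z₀ / piMin z₀) * n := by positivity
    have h5 : 0 ≤ n * (m * s) := by positivity
    nlinarith
  -- Twice `2A + 16 n m s` gives coefficients 4 on `ε` and 32 on the noise.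
  nlinarith [mul_nonneg (mul_pos hn hp).le hε0]

end Deterministic

/-! ### Scalar subgaussian moments and the noise level. -/

section Noise

variable {n d r : ℕ}

lemma pow_four_le_exp_add_exp_neg (x : ℝ) : x ^ 4 ≤ 24 * (Real.exp x + Real.exp (-x)) := by
  have h := Real.pow_div_factorial_le_exp |x| (abs_nonneg x) 4
  rw [(by decide : Even 4).pow_abs] at h
  have h2 : Real.exp |x| ≤ Real.exp x + Real.exp (-x) := by
    rcases abs_cases x with ⟨hx, _⟩ | ⟨hx, _⟩ <;> rw [hx] <;>
      linarith [Real.exp_pos x, Real.exp_pos (-x)]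
  have h3 : (Nat.factorial 4 : ℝ) = 24 := by norm_num [Nat.factorial]
  rw [h3] at h
  linarith

/-- The fourth moment of a subgaussian variable. -/
lemma integral_pow_four_le {Ω : Type*} [MeasurableSpace Ω] {P : Measure Ω}
    {X : Ω → ℝ} {c : ℝ≥0} (hX : HasSubgaussianMGF X c P) :
    ∫ ω, X ω ^ 4 ∂P ≤ 96 * (c : ℝ) ^ 2 := by
  rcases eq_or_ne c 0 with rfl | hc
  · have h0 : (fun ω => X ω ^ 4) =ᵐ[P] 0 := by
      filter_upwards [hX.ae_eq_zero_of_hasSubgaussianMGF_zero] with ω hω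
      simp [hω]
    rw [integral_congr_ae h0]
    simp
  have hc' : (0 : ℝ) < c := by positivity
  -- At this scale both exponential moments are at most `exp (1/2) ≤ 2`, whence `24 * (2 + 2) = 96`.
  set t : ℝ := (√(c : ℝ))⁻¹ with ht
  have ht2 : t ^ 2 = (c : ℝ)⁻¹ := by rw [ht, inv_pow, Real.sq_sqrt hc'.le]
  have hexp : ∀ a : ℝ, a ^ 2 = (c : ℝ)⁻¹ → ∫ ω, Real.exp (a * X ω) ∂P ≤ 2 := by
    intro a ha
    refine (hX.mgf_le a).trans ?_
    rw [ha, mul_inv_cancel₀ hc'.ne']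
    have h1 : Real.exp (1 / 2) ^ 2 ≤ 2 ^ 2 := by
      rw [← Real.exp_nat_mul]
      norm_num
      linarith [Real.exp_one_lt_d9]
    exact (pow_le_pow_iff_left₀ (Real.exp_pos _).le zero_le_two two_ne_zero).1 h1
  have hpt : ∀ ω, X ω ^ 4 ≤
      24 * (c : ℝ) ^ 2 * (Real.exp (t * X ω) + Real.exp (-t * X ω)) := by
    intro ω
    have h := pow_four_le_exp_add_exp_neg (t * X ω)
    have h4 : X ω ^ 4 = (c : ℝ) ^ 2 * (t * X ω) ^ 4 := by
      rw [mul_pow, (by ring : t ^ 4 = (t ^ 2) ^ 2), ht2]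
      field_simp
    rw [h4, neg_mul]
    nlinarith [mul_le_mul_of_nonneg_left h (sq_nonneg (c : ℝ))]
  have hi := (hX.integrable_exp_mul t).add (hX.integrable_exp_mul (-t))
  refine (integral_mono_of_nonneg (.of_forall fun ω => by positivity) (hi.const_mul _)
    (.of_forall hpt)).trans ?_
  simp only [Pi.add_apply]
  rw [integral_const_mul, integral_add (hX.integrable_exp_mul t) (hX.integrable_exp_mul (-t))]
  have := add_le_add (hexp t ht2) (hexp (-t) (by rw [neg_sq, ht2]))
  nlinarith [sq_nonneg (c : ℝ)]

lemma sq_le_sigmaMaxSq (hd : 0 < d) (σ : Fin r → ℝ) (a : Fin r) : σ a ^ 2 ≤ sigmaMaxSq d σ := by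
  have : Nonempty (Fin d) := ⟨⟨0, hd⟩⟩
  have h : ‖Matrix.toEuclideanCLM (n := Fin d) (𝕜 := ℝ) (componentCov d σ a)‖ = σ a ^ 2 := by
    rw [componentCov, map_smul, map_one, norm_smul, norm_one, mul_one, Real.norm_of_nonneg
      (sq_nonneg _)]
  rw [← h]
  exact le_ciSup (f := fun a => ‖Matrix.toEuclideanCLM (n := Fin d) (𝕜 := ℝ) (componentCov d σ a)‖)
    (Set.finite_range _).bddAbove a

lemma sigmaMaxSq_nonneg (d : ℕ) (σ : Fin r → ℝ) : 0 ≤ sigmaMaxSq d σ :=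
  Real.iSup_nonneg fun _ => norm_nonneg _

/-! ### Moments and concentration of the projected noise. -/

section Probability

variable {Ω : Type*} [MeasurableSpace Ω] {P : Measure Ω}
  {z₀ : Fin n → Fin r} {σ : Fin r → ℝ} {κ : ℝ≥0} {W : Fin n → Ω → EuclideanSpace ℝ (Fin d)}

lemma IsSubgaussianNoise.memLp_coord (h : IsSubgaussianNoise P z₀ σ κ W) (i : Fin n) (j : Fin d) :
    MemLp (fun ω => W i ω j) 2 P := by
  have := (h.subgaussian i (EuclideanSpace.single j 1) (by simp)).memLp 2
  simpa [EuclideanSpace.inner_single_left] using this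

lemma IsSubgaussianNoise.memLp_inner_sq (h : IsSubgaussianNoise P z₀ σ κ W) (i : Fin n)
    {v : EuclideanSpace ℝ (Fin d)} (hv : ‖v‖ = 1) :
    MemLp (fun ω => inner ℝ v (W i ω) ^ 2) 2 P := by
  have h4 : MemLp (fun ω => inner ℝ v (W i ω)) 4 P := (h.subgaussian i v hv).memLp 4
  have hpqr : ENNReal.HolderTriple 4 4 2 := ⟨by
    rw [← two_mul, show (4 : ℝ≥0∞) = 2 * 2 by norm_num, ENNReal.mul_inv (by simp) (by simp),
      ← mul_assoc, ENNReal.mul_inv_cancel (by simp) (by simp), one_mul]⟩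
  have := h4.mul (r := 2) h4
  simpa [sq, Pi.mul_def] using this

variable [IsProbabilityMeasure P]

lemma IsSubgaussianNoise.integral_coord (h : IsSubgaussianNoise P z₀ σ κ W) (i : Fin n)
    (j : Fin d) : ∫ ω, W i ω j ∂P = 0 := by
  have hi : Integrable (W i) P := by
    rw [← MeasureTheory.memLp_one_iff_integrable, MeasureTheory.memLp_piLp_iff]
    exact fun j => (h.memLp_coord i j).mono_exponent (by norm_num)
  have := (EuclideanSpace.proj (𝕜 := ℝ) j : EuclideanSpace ℝ (Fin d) →L[ℝ] ℝ).integral_comp_comm hi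
  rw [h.mean_zero i] at this
  simpa using this

/-- Expand the quadratic form of the covariance, which is isotropic. -/
lemma IsSubgaussianNoise.integral_inner_sq (h : IsSubgaussianNoise P z₀ σ κ W) (i : Fin n)
    {u : EuclideanSpace ℝ (Fin d)} (hu : ‖u‖ = 1) :
    ∫ ω, inner ℝ u (W i ω) ^ 2 ∂P = σ (z₀ i) ^ 2 := by
  have hint : ∀ j k, Integrable (fun ω => u j * u k * (W i ω j * W i ω k)) P := fun j k =>
    ((h.memLp_coord i j).integrable_mul (h.memLp_coord i k)).const_mul _
  have hcov : ∀ j k, ∫ ω, W i ω j * W i ω k ∂P = componentCov d σ (z₀ i) j k := by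
    intro j k
    rw [← h.cov i j k, covariance_eq_sub (h.memLp_coord i j) (h.memLp_coord i k),
      h.integral_coord, zero_mul, sub_zero]
    rfl
  have hexp : ∀ ω, inner ℝ u (W i ω) ^ 2 = ∑ j, ∑ k, u j * u k * (W i ω j * W i ω k) := by
    intro ω
    rw [PiLp.inner_apply, sq, Finset.sum_mul_sum]
    refine Finset.sum_congr rfl fun j _ => Finset.sum_congr rfl fun k _ => ?_
    simp only [RCLike.inner_apply, conj_trivial]
    ring
  simp_rw [hexp]
  rw [integral_finsetSum _ fun j _ => integrable_finsetSum _ fun k _ => hint j k]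
  have hu2 : ∑ j, u j ^ 2 = 1 := by
    rw [← EuclideanSpace.real_norm_sq_eq, hu, one_pow]
  calc ∑ j, ∫ ω, ∑ k, u j * u k * (W i ω j * W i ω k) ∂P
      = ∑ j, ∑ k, u j * u k * componentCov d σ (z₀ i) j k := by
        refine Finset.sum_congr rfl fun j _ => ?_
        rw [integral_finsetSum _ fun k _ => hint j k]
        refine Finset.sum_congr rfl fun k _ => ?_
        rw [integral_const_mul, hcov]
    _ = ∑ j, σ (z₀ i) ^ 2 * u j ^ 2 := by
        refine Finset.sum_congr rfl fun j _ => ?_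
        simp only [componentCov, Matrix.smul_apply, Matrix.one_apply, smul_eq_mul, mul_ite,
          mul_one, mul_zero, Finset.sum_ite_eq, Finset.mem_univ, if_true]
        ring
    _ = σ (z₀ i) ^ 2 := by rw [← Finset.mul_sum, hu2, mul_one]

variable {q : ℕ} {u : Fin q → EuclideanSpace ℝ (Fin d)}

lemma IsSubgaussianNoise.memLp_sum_inner_sq (h : IsSubgaussianNoise P z₀ σ κ W)
    (hu : Orthonormal ℝ u) (i : Fin n) : MemLp (fun ω => ∑ l, inner ℝ (u l) (W i ω) ^ 2) 2 P :=
  memLp_finsetSum _ fun l _ => h.memLp_inner_sq i (hu.1 l)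

lemma IsSubgaussianNoise.integral_sum_inner_sq (h : IsSubgaussianNoise P z₀ σ κ W)
    (hu : Orthonormal ℝ u) (i : Fin n) :
    ∫ ω, ∑ l, inner ℝ (u l) (W i ω) ^ 2 ∂P = q * σ (z₀ i) ^ 2 := by
  rw [integral_finsetSum _ fun l _ => (h.memLp_inner_sq i (hu.1 l)).integrable (by norm_num)]
  simp [h.integral_inner_sq i (hu.1 _)]

/-- The coordinates of one noise vector may be dependent, so Cauchy–Schwarz over the `q` directions
reduces to fourth moments. -/
lemma IsSubgaussianNoise.variance_sum_inner_sq_le (h : IsSubgaussianNoise P z₀ σ κ W)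
    (hu : Orthonormal ℝ u) (i : Fin n) :
    variance (fun ω => ∑ l, inner ℝ (u l) (W i ω) ^ 2) P ≤
      96 * (q * (κ * sigmaMaxSq d σ)) ^ 2 := by
  refine (variance_le_expectation_sq (h.memLp_sum_inner_sq hu i).aestronglyMeasurable).trans ?_
  have hint : ∀ l, Integrable (fun ω => (inner ℝ (u l) (W i ω) ^ 2) ^ 2) P := fun l =>
    (h.memLp_inner_sq i (hu.1 l)).integrable_sq
  have hpt : ∀ ω, (∑ l, inner ℝ (u l) (W i ω) ^ 2) ^ 2 ≤
      q * ∑ l, (inner ℝ (u l) (W i ω) ^ 2) ^ 2 := fun ω => by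
    simpa using sq_sum_le_card_mul_sum_sq (s := Finset.univ)
      (f := fun l => inner ℝ (u l) (W i ω) ^ 2)
  have h1 : ∫ ω, (∑ l, inner ℝ (u l) (W i ω) ^ 2) ^ 2 ∂P ≤
      ∫ ω, q * ∑ l, (inner ℝ (u l) (W i ω) ^ 2) ^ 2 ∂P :=
    integral_mono_of_nonneg (.of_forall fun ω => by positivity)
      ((integrable_finsetSum _ fun l _ => hint l).const_mul _) (.of_forall hpt)
  have h4 : ∀ l, ∫ ω, (inner ℝ (u l) (W i ω) ^ 2) ^ 2 ∂P ≤ 96 * (κ * sigmaMaxSq d σ) ^ 2 := by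
    intro l
    have := integral_pow_four_le (h.subgaussian i (u l) (hu.1 l))
    rw [NNReal.coe_mul, Real.coe_toNNReal _ (sigmaMaxSq_nonneg d σ)] at this
    simpa only [← pow_mul] using this
  rw [integral_const_mul, integral_finsetSum _ fun l _ => hint l] at h1
  have h5 := Finset.sum_le_card_nsmul Finset.univ _ _ fun l _ => h4 l
  rw [Finset.card_univ, Fintype.card_fin, nsmul_eq_mul] at h5
  calc _ ≤ _ := h1
    _ ≤ q * (q * (96 * (κ * sigmaMaxSq d σ) ^ 2)) := mul_le_mul_of_nonneg_left h5 (by positivity)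
    _ = _ := by ring

/-- The noise along `q` orthonormal directions concentrates. -/
lemma IsSubgaussianNoise.measure_noise_gt_le (h : IsSubgaussianNoise P z₀ σ κ W)
    (hu : Orthonormal ℝ u) {m : ℝ} (hm : 0 < m) (hqm : q ≤ m) (hd : 0 < d) (hn : 0 < n) :
    P {ω | 2 * (n * (m * sigmaMaxSq d σ)) < ∑ i, ∑ l, inner ℝ (u l) (W i ω) ^ 2} ≤
      ENNReal.ofReal (96 * (κ : ℝ) ^ 2 / n) := by
  have hn' : (0 : ℝ) < n := by exact_mod_cast hn
  -- At noise level zero the Chebyshev radius would vanish, but then the noise is almost surely zero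
  -- along each `u l`.
  rcases (sigmaMaxSq_nonneg d σ).eq_or_lt with h0 | hpos
  · have hz : ∀ i l, (fun ω => inner ℝ (u l) (W i ω)) =ᵐ[P] 0 := fun i l => by
      have := h.subgaussian i (u l) (hu.1 l)
      rw [← h0, Real.toNNReal_zero, mul_zero] at this
      exact this.ae_eq_zero_of_hasSubgaussianMGF_zero
    have hall : ∀ᵐ ω ∂P, ∀ i l, inner ℝ (u l) (W i ω) = 0 :=
      ae_all_iff.2 fun i => ae_all_iff.2 fun l => hz i l
    refine le_of_eq_of_le (measure_mono_null (fun ω hω => ?_) (ae_iff.1 hall)) zero_le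
    intro hc
    simp [← h0, hc] at hω
  · set s := sigmaMaxSq d σ with hs
    set G : Fin n → Ω → ℝ := fun i ω => ∑ l, inner ℝ (u l) (W i ω) ^ 2 with hG
    have hL : ∀ i, MemLp (G i) 2 P := fun i => h.memLp_sum_inner_sq hu i
    have hmean : P[∑ i, G i] ≤ n * (m * s) := by
      simp only [Finset.sum_apply]
      rw [integral_finsetSum _ fun i _ => (hL i).integrable (by norm_num)]
      have : ∀ i ∈ Finset.univ, ∫ ω, G i ω ∂P ≤ m * s := fun i _ => by
        rw [h.integral_sum_inner_sq hu]
        exact mul_le_mul hqm (sq_le_sigmaMaxSq hd σ _) (sq_nonneg _) hm.le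
      simpa using Finset.sum_le_card_nsmul _ _ _ this
    have hindep : iIndepFun G P := by
      refine h.indep.comp (fun _ x => ∑ l, inner ℝ (u l) x ^ 2) fun _ => ?_
      fun_prop
    have hvar : variance (∑ i, G i) P ≤ n * (96 * (m * (κ * s)) ^ 2) := by
      rw [IndepFun.variance_sum (fun i _ => hL i) fun i _ j _ hij => hindep.indepFun hij]
      have : ∀ i ∈ Finset.univ, variance (G i) P ≤ 96 * (m * (κ * s)) ^ 2 := fun i _ => by
        refine (h.variance_sum_inner_sq_le hu i).trans ?_
        gcongr
      simpa using Finset.sum_le_card_nsmul _ _ _ this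
    -- The deviation equals the bound on the mean, hence the factor 2 in the threshold.
    have hc : 0 < n * (m * s) := by positivity
    refine (measure_mono fun ω hω => ?_).trans
      ((meas_ge_le_variance_div_sq (memLp_finsetSum' Finset.univ fun i _ => hL i) hc).trans
        (ENNReal.ofReal_le_ofReal ?_))
    · simp only [Set.mem_ofPred_eq] at hω ⊢
      refine le_trans ?_ (le_abs_self _)
      rw [Finset.sum_apply]
      simp only [hG] at hmean ⊢
      linarith
    · rw [div_le_div_iff₀ (by positivity) hn']
      calc _ ≤ n * (96 * (m * (κ * s)) ^ 2) * n := by gcongr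
        _ = _ := by ring

end Probability

end Noise

end MATR

/-! ### The selection guarantee. -/

open MATR in
/-- `C` is universal. "With high probability" is the part from `κ` to `N`: the failure probability
is at most `η` once `n` exceeds a bound that depends on `η` and the subgaussian constant `κ` only.
The exceptional set is measured by the outer measure, and outside of it the guarantee holds at once
for all candidate lists, all ways to break ties and all `ε`. -/
theorem corollary2 :
    ∃ C : ℝ, 0 < C ∧
      ∀ (κ : ℝ≥0) (η : ℝ), 0 < η →
      ∃ N : ℕ, ∀ (n d r : ℕ), N ≤ n → 2 ≤ r →
      ∀ (z₀ : Fin n → Fin r), Function.Surjective z₀ →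
      ∀ (μ : Fin r → EuclideanSpace ℝ (Fin d)), Function.Injective μ →
      ∀ (σ : Fin r → ℝ)
        (Ω : Type*) [MeasurableSpace Ω] (P : Measure Ω) [IsProbabilityMeasure P]
        (W : Fin n → Ω → EuclideanSpace ℝ (Fin d)),
      IsSubgaussianNoise P z₀ σ κ W →
      P {ω | ¬ ∀ (T : ℕ) (θ : Fin T → ℝ) (zhat : Fin T → Fin n → Fin r) (tstar : Fin T) (ε : ℝ),
          (∀ t, 0 < θ t) →
          (∀ t, IsSpectralClustering
            (gaussianKernel (mixtureData z₀ μ fun i => W i ω) (θ t)) (zhat t)) →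
          IsMATRChoice (negSqDist (mixtureData z₀ μ fun i => W i ω)) zhat tstar →
          (∃ t₀, traceInner (normalizedClustering (zhat t₀))
                (negSqDist (mixtureData z₀ μ fun i => W i ω)) ≥
              traceInner (normalizedClustering z₀) (referenceMatrix z₀ μ fun i => W i ω)
                - n * piMin z₀ * ε) →
          frobSq (normalizedClustering (zhat tstar) - normalizedClustering z₀) ≤
            C * ((ε + r * (piMax z₀ / piMin z₀) * sigmaMaxSq d σ *
              (piMax z₀ / piMin z₀ + min r d)) / deltaSep μ ^ 2)}
        ≤ ENNReal.ofReal η := by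
  refine ⟨32, by norm_num, fun κ η hη => ⟨⌈96 * (κ : ℝ) ^ 2 / η⌉₊, ?_⟩⟩
  intro n d r hN hr z₀ hz₀ μ hμ σ Ω _ P _ W hW
  have hn := size_pos_of_surjective hz₀ hr
  have hn' : (0 : ℝ) < n := by exact_mod_cast hn
  -- In dimension zero two centers would coincide.
  have hd : 0 < d := by
    rcases Nat.eq_zero_or_pos d with rfl | hd
    · have := hμ (Subsingleton.elim (μ ⟨0, by omega⟩) (μ ⟨1, by omega⟩))
      simp at this
    · exact hd
  -- The directions depend on the centers alone, so a single noise event serves all candidate lists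
  -- and all `ε`.
  obtain ⟨q, u, hq, hu, hμu⟩ := exists_orthonormal_centers μ
  have hm : (0 : ℝ) < (min r d : ℕ) := by exact_mod_cast lt_min (by omega) hd
  have hqm : (q : ℝ) ≤ (min r d : ℕ) := by exact_mod_cast hq
  have hfail : 96 * (κ : ℝ) ^ 2 / n ≤ η := by
    have h := Nat.ceil_le.1 hN
    rw [div_le_iff₀ hη] at h
    rw [div_le_iff₀ hn']
    linarith
  refine (measure_mono ?_).trans
    ((hW.measure_noise_gt_le hu hm hqm hd hn).trans (ENNReal.ofReal_le_ofReal hfail))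
  intro ω hω
  by_contra hgood
  refine hω ?_
  intro T θ zhat tstar ε _ hspec hmax ⟨t₀, ht₀⟩
  obtain ⟨_, _, hsurj, _⟩ := hspec tstar
  exact frobSq_sub_le_of_noise_le hsurj hz₀ hr hμ hu hμu hm.le (sigmaMaxSq_nonneg d σ)
    (not_lt.1 hgood) (hmax t₀) ht₀
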